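/- **Definitions.** Let $f:\{0,1\}^I\to\{0,1\}$ be a boolean function over a finite index set $I$ and $x\in\{0,1\}^I$. A *block* of $f$ at $x$ is a set $B\subseteq I$ with $f(x\oplus B)\ne f(x)$, where $x\oplus B$ is $x$ with the bits in $B$ complemented. A *fractional witness* of $f$ at $x$ is a map $w:I\to[0,1]$ with $\sum_{i\in B}w(i)\ge 1$ for every block $B$ of $f$ at $x$; it is a *witness* if it is $\{0,1\}$-valued. Put $|w|=\sum_{i\in I} w(i)$. Let $C_x(f)$ (resp. $C^*_x(f)$) be the minimum of $|w|$ over all witnesses (resp. fractional witnesses) of $f$ at $x$, and let $C(f)=\max_x C_x(f)$ and $C^*(f)=\max_x C^*_x(f)$ be the certificate complexity and the fractional certificate complexity of $f$. Let $f^{(1)}=f$ and $f^{(k)}=f\circ f^{(k-1)}$ for $k\ge 2$, where $f\circ g$ is evaluated by evaluating $g$ on $|I|$ disjoint blocks of variables and then $f$ on the outputs. For $m\in\{C,C^*\}$ let $m^{\lim}(f)=\liminf_{k\to\infty} m(f^{(k)})^{1/k}$. For $\alpha^0,\alpha^1\in\{0,1\}^I$ with $f(\alpha^0)=0$, $f(\alpha^1)=1$,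 and $w^0,w^1:I\to[0,1]$, the *profile matrix* is the $2\times2$ matrix, with rows and columns indexed by $\{0,1\}$, whose $(s,t)$ entry is $\sum_{j:\,\alpha^s_j=t}w^s(j)$. For a real square matrix $M$ let $\rho(M)$ be the maximum of $|\lambda|$ over its complex eigenvalues $\lambda$. Let $\widehat{C}(f)$ (resp. $\widehat{C^*}(f)$) be the maximum, over all pairs $(\alpha^0,\alpha^1)$ with $f(\alpha^0)=0$ and $f(\alpha^1)=1$, of the minimum of $\rho(M)$ over all profile matrices $M$ in which $w^s$ is a witness (resp. fractional witness) of $f$ at $\alpha^s$ for $s=0,1$. For measures $a,b$ of boolean functions and $r>0$ write $a\le_r b$ if there are constants $c_1,c_2$ with $a(f)\le c_1\,b(f)^r+c_2$ for every boolean function $f$. Call $a$ polynomially bounded by $b$ if $a\le_r b$ for some $r>0$; in this case let $\mathrm{crit}(a,b)=\inf\{r>0: a\le_r b\}$. **Statement.** Let $n$ be a positive even perfect square, $k=2\sqrt n$ and $d=\sqrt n$. Divide the $n$ variables into $n/k$ disjoint groups of $k$ variables, and let $f:\{0,1\}^n\to\{0,1\}$ accept $x$ if and only if $x$ has at least $d$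 ones and all the ones of $x$ lie in a single group. Then $$\widehat{C^*}(f)\le 4\sqrt n,\qquad \widehat{C}(f)\ge \frac n2,\qquad (C^*)^{\lim}(f)\le 4\sqrt n,\qquad C^{\lim}(f)\ge\frac n2 .$$ Moreover, $C$ is polynomially bounded by $C^*$, and $\mathrm{crit}(C,C^*)\ge 2$. -/

import Mathlib

namespace BoolComplexity

noncomputable section

/-- A (total) boolean function over the index set `I`; `false` is 0 and `true` is 1. -/
abbrev BoolFun (I : Type) : Type := (I → Bool) → Bool

/-- The assignment `x ⊕ B`, obtained from `x` by complementing the bits in `B`. -/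
def flipBits {I : Type} (x : I → Bool) (B : Finset I) : I → Bool :=
  open Classical in fun i => if i ∈ B then !(x i) else x i

/-- `B` is a block of `f` at `x`. -/
def IsBlock {I : Type} (f : BoolFun I) (x : I → Bool) (B : Finset I) : Prop :=
  f (flipBits x B) ≠ f x

/-- A map that associates to every function-assignment pair `(f, x)` a family of real weight
functions on the index set of `f`. -/
abbrev Assemblage : Type 1 :=
  ∀ (I : Type) [Fintype I], BoolFun I → (I → Bool) → Set (I → ℝ)

/-- The witness assemblage: boolean weight functions that are hitting sets for the blocks
of `f` at `x`. -/
def witness : Assemblage := fun I _ f x =>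
  {w : I → ℝ | (∀ i, w i = 0 ∨ w i = 1) ∧ ∀ B : Finset I, IsBlock f x B → 1 ≤ ∑ i ∈ B, w i}

/-- The fractional witness assemblage: `[0,1]`-valued weight functions that are fractional
hitting sets for the blocks of `f` at `x`. -/
def fracWitness : Assemblage := fun I _ f x =>
  {w : I → ℝ | (∀ i, 0 ≤ w i ∧ w i ≤ 1) ∧ ∀ B : Finset I, IsBlock f x B → 1 ≤ ∑ i ∈ B, w i}

/-- A complexity measure of boolean functions. -/
abbrev Measure : Type 1 := ∀ (I : Type) [Fintype I], BoolFun I → ℝ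

/-- The local complexity `m_x(f)` induced by an assemblage: the minimum of `|w|` over the weight
functions `w` that the assemblage associates to `(f, x)`. For the two assemblages above this family
is nonempty and compact, so that the infimum is attained. -/
def localMeasure (A : Assemblage) {I : Type} [Fintype I] (f : BoolFun I) (x : I → Bool) : ℝ :=
  sInf ((fun w : I → ℝ => ∑ i, w i) '' A I f x)

/-- `m_b(f)`, the maximum of `m_x(f)` over the assignments `x` with `f x = b`
(it is `0` if there is no such `x`). -/
def sideMeasure (A : Assemblage) {I : Type} [Fintype I] (f : BoolFun I) (b : Bool) : ℝ :=
  sSup ((fun x : I → Bool => localMeasure A f x) '' {x | f x = b})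

/-- The complexity measure `m(f) = max (m_0(f), m_1(f))` induced by an assemblage. -/
def measure (A : Assemblage) : Measure := fun _ _ f =>
  max (sideMeasure A f false) (sideMeasure A f true)

/-- Certificate complexity `C`. -/
def certC : Measure := measure witness

/-- Fractional certificate complexity `C*`. -/
def fracCertC : Measure := measure fracWitness

/-- The composition `f ∘ g`: evaluate `g` on each block `{i} × J`, then `f` on the outputs. -/
def comp {I J : Type} (f : BoolFun I) (g : BoolFun J) : BoolFun (I × J) :=
  fun x => f fun i => g fun j => x (i, j)

/-- The index set of the `(k+1)`-st iterated composition of a function over `I`. -/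
def IterIndex (I : Type) : ℕ → Type
  | 0 => I
  | k + 1 => I × IterIndex I k

instance instFintypeIterIndex (I : Type) [Fintype I] : (k : ℕ) → Fintype (IterIndex I k)
  | 0 => inferInstanceAs (Fintype I)
  | k + 1 =>
    haveI := instFintypeIterIndex I k
    inferInstanceAs (Fintype (I × IterIndex I k))

/-- `iterComp f k` is the `(k+1)`-st iterated composition of `f`: the first one is `f`, and each
next one is `f` composed with the preceding one. -/
def iterComp {I : Type} (f : BoolFun I) : (k : ℕ) → BoolFun (IterIndex I k)
  | 0 => f
  | k + 1 => comp f (iterComp f k)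

/-- The composition limit `liminf_{k → ∞} m(f^(k))^(1/k)`; `iterComp f k` is `f^(k+1)`. -/
def compLimit (m : Measure) {I : Type} [Fintype I] (f : BoolFun I) : ℝ :=
  Filter.liminf (fun k : ℕ => (m (IterIndex I k) (iterComp f k)) ^ (1 / ((k : ℝ) + 1)))
    Filter.atTop

/-- An assignment selector `(α⁰, α¹)` is `f`-compatible if `f(α⁰) = 0` and `f(α¹) = 1`. -/
def IsCompatible {I : Type} (f : BoolFun I) (α : Bool → I → Bool) : Prop :=
  ∀ b : Bool, f (α b) = b

/-- The profile matrix of an assignment selector `α` and a weight function selector `w`: the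
`(s, t)` entry is the `wˢ`-weight of the indices `j` with `αˢ_j = t`. -/
def profileMatrix {I : Type} [Fintype I] (α : Bool → I → Bool) (w : Bool → I → ℝ) :
    Matrix Bool Bool ℝ :=
  Matrix.of fun s t => ∑ j with α s j = t, w s j

/-- The profile matrix family of `f` at the assignment selector `α`. -/
def profileFamily (A : Assemblage) {I : Type} [Fintype I] (f : BoolFun I) (α : Bool → I → Bool) :
    Set (Matrix Bool Bool ℝ) :=
  {M | ∃ w : Bool → I → ℝ, (∀ b, w b ∈ A I f (α b)) ∧ M = profileMatrix α w}

/-- `ρ(M)`: the maximum of `|μ|` over all (complex) eigenvalues `μ` of the real matrix `M`. -/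
def maxEigenvalue (M : Matrix Bool Bool ℝ) : ℝ :=
  sSup {r : ℝ | ∃ μ : ℂ,
    Module.End.HasEigenvalue (Matrix.toLin' (M.map (fun a : ℝ => (a : ℂ)))) μ ∧ r = ‖μ‖}

/-- The characteristic value for `(f, α)`: the minimum of `ρ` over the profile matrix family. -/
def charValueAt (A : Assemblage) {I : Type} [Fintype I] (f : BoolFun I)
    (α : Bool → I → Bool) : ℝ :=
  sInf (maxEigenvalue '' profileFamily A f α)

/-- The characteristic value of `f`: the maximum of the characteristic values for `(f, α)` over
all `f`-compatible assignment selectors `α`. -/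
def charValue (A : Assemblage) {I : Type} [Fintype I] (f : BoolFun I) : ℝ :=
  sSup ((fun α : Bool → I → Bool => charValueAt A f α) '' {α | IsCompatible f α})

/-- `a ≤_r b`: there are constants `c₁`, `c₂` such that `a(f) ≤ c₁ b(f)^r + c₂` for every boolean
function `f`. -/
def BoundedByPower (a b : Measure) (r : ℝ) : Prop :=
  ∃ c₁ c₂ : ℝ, ∀ (I : Type) [Fintype I] (f : BoolFun I), a I f ≤ c₁ * (b I f) ^ r + c₂

/-- `a` is polynomially bounded by `b`. -/
def PolynomiallyBounded (a b : Measure) : Prop :=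
  ∃ r : ℝ, 0 < r ∧ BoundedByPower a b r

/-- The critical exponent `crit(a, b)`: the infimum of the exponents `r > 0` with `a ≤_r b`.
It is meant for measures `a` that are polynomially bounded by `b`. -/
def crit (a b : Measure) : ℝ :=
  sInf {r : ℝ | 0 < r ∧ BoundedByPower a b r}

/-- The single group function on `n` variables, which are divided into the `n / k` groups of `k`
consecutive indices: it accepts `x` iff `x` has at least `d` ones and all ones of `x` lie in a
single group. -/
def singleGroup (n k d : ℕ) : BoolFun (Fin n) := fun x =>
  decide (d ≤ (Finset.univ.filter fun i : Fin n => x i = true).card ∧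
    ∃ g : Fin (n / k), ∀ i : Fin n, x i = true → (i : ℕ) / k = (g : ℕ))

end

end BoolComplexity

/-! Put m = √n. At the zero assignment a fractional witness may spread weight 1/m everywhere, at
cost m, while a 0/1 witness needs m ones in each group of 2m variables, at cost n/2. For large n
some accepting assignments cost about n in either measure, so the gap in the global measures appears
only under iteration.

Upper bounds: price a 0 at 1 and a 1 at m. Every x has a fractional witness of priced weight at most
4m times the price of f(x) (`IsSingleGroup.hasFracProfileBound`). Such an inequality bounds the
spectral radius of a profile matrix (`maxEigenvalue_le`) and propagates through composition, because
products of fractional witnesses are fractional witnesses (`mul_mem_fracWitness_comp`).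

Lower bounds: as f(0) = 0, the zero assignment presents zeros to f at every level. Costs of 0/1
witnesses multiply (`mul_le_sum_witness_comp`), and the profile matrix with α⁰ = 0 is triangular.

C ≤ (C*)² comes from a maximal family of disjoint minimal blocks. If an exponent r < 2 sufficed, the
iterates would give (m²/2)^k ≤ D (4m)^(rk) for all k with D independent of k, which fails for large
m. -/

namespace BoolComplexity

open Finset Filter Topology

/-! ### Blocks and their behaviour under composition -/

section Flip

variable {I J : Type}

theorem flipBits_of_mem {x : I → Bool} {B : Finset I} {i : I} (h : i ∈ B) :
    flipBits x B i = !(x i) := by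
  simp [flipBits, h]

theorem flipBits_of_notMem {x : I → Bool} {B : Finset I} {i : I} (h : i ∉ B) :
    flipBits x B i = x i := by
  simp [flipBits, h]

theorem flipBits_empty (x : I → Bool) : flipBits x ∅ = x := by
  ext i; simp [flipBits]

theorem IsBlock.nonempty {f : BoolFun I} {x : I → Bool} {B : Finset I} (h : IsBlock f x B) :
    B.Nonempty := by
  rcases B.eq_empty_or_nonempty with rfl | h'
  · exact absurd (by rw [flipBits_empty]) h
  · exact h'

theorem flipBits_filter_ne [Fintype I] (x y : I → Bool) :
    flipBits x (univ.filter fun i => x i ≠ y i) = y := by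
  ext i
  by_cases h : x i = y i
  · rw [flipBits_of_notMem (by simpa using h), h]
  · rw [flipBits_of_mem (by simpa using h)]
    cases hx : x i <;> cases hy : y i <;> simp_all

open Classical in
/-- The part of a set of variables of `f ∘ g` that lies in the `i`-th copy of the variables
of `g`. -/
noncomputable def slice [Fintype J] (B : Finset (I × J)) (i : I) : Finset J :=
  univ.filter fun j => (i, j) ∈ B

theorem flipBits_slice [Fintype J] (x : I × J → Bool) (B : Finset (I × J)) (i : I) :
    flipBits (fun j => x (i, j)) (slice B i) = fun j => flipBits x B (i, j) := by
  ext j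
  by_cases h : (i, j) ∈ B
  · rw [flipBits_of_mem h, flipBits_of_mem (by simpa [slice] using h)]
  · rw [flipBits_of_notMem h, flipBits_of_notMem (by simpa [slice] using h)]

theorem sum_eq_sum_slice [Fintype I] [Fintype J] (B : Finset (I × J)) (h : I × J → ℝ) :
    ∑ p ∈ B, h p = ∑ i, ∑ j ∈ slice B i, h (i, j) := by
  classical
  simp only [slice, sum_filter]
  rw [← Fintype.sum_prod_type' (f := fun i j => if (i, j) ∈ B then h (i, j) else 0)]
  simp

-- The copies of `g` whose output changes under `B` are exactly those whose slice is a block, and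
-- `f` sees only these changes.
open Classical in
theorem isBlock_comp_iff [Fintype I] [Fintype J] (f : BoolFun I) (g : BoolFun J)
    (x : I × J → Bool) (B : Finset (I × J)) :
    IsBlock (comp f g) x B ↔ IsBlock f (fun i => g fun j => x (i, j))
      (univ.filter fun i => IsBlock g (fun j => x (i, j)) (slice B i)) := by
  have : flipBits (fun i => g fun j => x (i, j))
      (univ.filter fun i => IsBlock g (fun j => x (i, j)) (slice B i)) =
      fun i => g fun j => flipBits x B (i, j) := by
    rw [← flipBits_filter_ne (fun i => g fun j => x (i, j))
      (fun i => g fun j => flipBits x B (i, j))]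
    congr 1
    ext i
    simp [IsBlock, flipBits_slice, eq_comm]
  simp only [IsBlock] at this ⊢
  rw [this]
  rfl

end Flip

/-! ### Elementary bounds on the measures -/

section Basic

variable {I J : Type} [Fintype I] [Fintype J]

theorem one_mem_witness (f : BoolFun I) (x : I → Bool) : (fun _ => 1) ∈ witness I f x := by
  refine ⟨fun _ => Or.inr rfl, fun B hB => ?_⟩
  have := hB.nonempty.card_pos
  simpa using this

theorem indicator_mem_witness [DecidableEq I] {f : BoolFun I} {x : I → Bool} {S : Finset I}
    (h : ∀ B, IsBlock f x B → ∃ i ∈ B, i ∈ S) :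
    (fun i => if i ∈ S then (1 : ℝ) else 0) ∈ witness I f x := by
  refine ⟨fun i => by by_cases h : i ∈ S <;> simp [h], fun B hB => ?_⟩
  obtain ⟨i, hi, hS⟩ := h B hB
  calc (1 : ℝ) = if i ∈ S then (1 : ℝ) else 0 := by rw [if_pos hS]
    _ ≤ _ := single_le_sum (f := fun i => if i ∈ S then (1 : ℝ) else 0)
      (fun j _ => by split_ifs <;> norm_num) hi

theorem witness_subset_fracWitness (f : BoolFun I) (x : I → Bool) :
    witness I f x ⊆ fracWitness I f x := by
  rintro w ⟨h, hB⟩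
  refine ⟨fun i => ?_, hB⟩
  rcases h i with h | h <;> simp [h]

theorem sum_nonneg_of_mem {f : BoolFun I} {x : I → Bool} {w : I → ℝ}
    (h : w ∈ fracWitness I f x) : 0 ≤ ∑ i, w i :=
  sum_nonneg fun i _ => (h.1 i).1

theorem localMeasure_le {A : Assemblage} {f : BoolFun I} {x : I → Bool}
    (hA : A I f x ⊆ fracWitness I f x) {w : I → ℝ} (hw : w ∈ A I f x) :
    localMeasure A f x ≤ ∑ i, w i := by
  refine csInf_le ⟨0, ?_⟩ ⟨w, hw, rfl⟩
  rintro _ ⟨v, hv, rfl⟩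
  exact sum_nonneg_of_mem (hA hv)

theorem le_localMeasure {A : Assemblage} {f : BoolFun I} {x : I → Bool}
    (hA : witness I f x ⊆ A I f x) {c : ℝ} (h : ∀ w ∈ A I f x, c ≤ ∑ i, w i) :
    c ≤ localMeasure A f x := by
  refine le_csInf ⟨_, _, hA (one_mem_witness f x), rfl⟩ ?_
  rintro _ ⟨v, hv, rfl⟩
  exact h v hv

theorem localMeasure_le_measure (A : Assemblage) (f : BoolFun I) (x : I → Bool) :
    localMeasure A f x ≤ measure A I f := by
  have h : localMeasure A f x ≤ sideMeasure A f (f x) :=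
    le_csSup ((Set.toFinite _).image _).bddAbove ⟨x, rfl, rfl⟩
  refine h.trans ?_
  cases f x
  · exact le_max_left _ _
  · exact le_max_right _ _

/-- Nonnegativity of `c` covers constant functions, where one side is the supremum of the empty set,
which is 0. -/
theorem measure_le {A : Assemblage} {f : BoolFun I} {c : ℝ} (hc : 0 ≤ c)
    (h : ∀ x, localMeasure A f x ≤ c) : measure A I f ≤ c := by
  refine max_le ?_ ?_ <;>
  · refine Real.sSup_le ?_ hc
    rintro _ ⟨x, -, rfl⟩
    exact h x

theorem certC_le_card (f : BoolFun I) : certC I f ≤ Fintype.card I := by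
  refine measure_le (Nat.cast_nonneg _) fun x => ?_
  simpa using localMeasure_le (witness_subset_fracWitness f x) (one_mem_witness f x)

theorem fracCertC_nonneg (f : BoolFun I) : 0 ≤ fracCertC I f :=
  (le_localMeasure (witness_subset_fracWitness f fun _ => false)
    fun _ hw => sum_nonneg_of_mem hw).trans (localMeasure_le_measure _ f _)

end Basic

/-! ### The quadratic bound of C by C* -/

section PolynomialBound

variable {I : Type} [Fintype I]

/-- A fractional witness has weight at least the number of members of any family of disjoint
blocks. -/
theorem card_le_sum_of_disjoint_blocks {f : BoolFun I} {x : I → Bool} {w : I → ℝ}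
    (hw : w ∈ fracWitness I f x) {P : Finset (Finset I)} (hP : ∀ B ∈ P, IsBlock f x B)
    (hd : (P : Set (Finset I)).PairwiseDisjoint id) : (P.card : ℝ) ≤ ∑ i, w i := by
  classical
  calc (P.card : ℝ) = ∑ B ∈ P, 1 := by simp
    _ ≤ ∑ B ∈ P, ∑ i ∈ B, w i := sum_le_sum fun B hB => hw.2 B (hP B hB)
    _ = ∑ i ∈ P.biUnion id, w i := (sum_biUnion hd).symm
    _ ≤ ∑ i, w i := sum_le_sum_of_subset_of_nonneg (subset_univ _) fun i _ _ => (hw.1 i).1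

theorem card_le_fracCertC_of_disjoint_blocks {f : BoolFun I} {x : I → Bool}
    {P : Finset (Finset I)} (hP : ∀ B ∈ P, IsBlock f x B)
    (hd : (P : Set (Finset I)).PairwiseDisjoint id) : (P.card : ℝ) ≤ fracCertC I f :=
  (le_localMeasure (witness_subset_fracWitness f x)
    fun _ hw => card_le_sum_of_disjoint_blocks hw hP hd).trans (localMeasure_le_measure _ f x)

/-- Minimal blocks have size at most the sensitivity, hence at most `C*`. -/
theorem card_le_fracCertC_of_minimal {f : BoolFun I} {x : I → Bool} {B : Finset I}
    (hB : Minimal (IsBlock f x) B) : (B.card : ℝ) ≤ fracCertC I f := by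
  classical
  -- At `flipBits x B` each singleton of `B` is a block: it leads to a proper subset of `B` flipped
  -- in `x`, which by minimality does not change the value.
  have key := card_le_fracCertC_of_disjoint_blocks (f := f) (x := flipBits x B)
    (P := B.image fun i => {i}) ?_ ?_
  · rwa [card_image_of_injective _ singleton_injective] at key
  · intro S hS
    obtain ⟨i, hi, rfl⟩ := mem_image.1 hS
    have h1 : flipBits (flipBits x B) {i} = flipBits x (B.erase i) := by
      ext j
      by_cases hj : j = i
      · subst hj
        rw [flipBits_of_mem (by simp), flipBits_of_mem hi, flipBits_of_notMem (by simp)]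
        simp
      · rw [flipBits_of_notMem (by simpa using hj)]
        simp [flipBits, hj]
    have h2 : ¬ IsBlock f x (B.erase i) := fun h =>
      notMem_erase i B (hB.le_of_le h (erase_subset i B) hi)
    have h3 : f (flipBits x (B.erase i)) = f x := not_not.1 h2
    rw [IsBlock, h1, h3]
    exact hB.prop.symm
  · intro S hS T hT hne
    obtain ⟨i, -, rfl⟩ := mem_image.1 (mem_coe.1 hS)
    obtain ⟨j, -, rfl⟩ := mem_image.1 (mem_coe.1 hT)
    exact disjoint_singleton.2 fun h => hne (by rw [h])

/-- The union of a maximal disjoint family of minimal blocks meets every block. Both the number of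
members and the size of each are at most C*. -/
theorem certC_le_fracCertC_sq (f : BoolFun I) : certC I f ≤ fracCertC I f ^ 2 := by
  classical
  refine measure_le (sq_nonneg _) fun x => ?_
  let F : Finset (Finset (Finset I)) := univ.filter fun P =>
    (∀ B ∈ P, Minimal (IsBlock f x) B) ∧ (P : Set (Finset I)).PairwiseDisjoint id
  obtain ⟨P, hP⟩ := F.exists_maximal ⟨∅, by simp [F]⟩
  obtain ⟨hmin, hd⟩ := (mem_filter.1 hP.prop).2
  have hw : (fun i => if i ∈ P.biUnion id then (1 : ℝ) else 0) ∈ witness I f x := by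
    refine indicator_mem_witness fun B hB => ?_
    obtain ⟨D, hDB, hD⟩ := exists_minimal_le_of_wellFoundedLT (IsBlock f x) B hB
    obtain ⟨i, hi, hiU⟩ : ∃ i ∈ D, i ∈ P.biUnion id := by
      by_contra! hcon
      have hdis : ∀ S ∈ P, Disjoint D S := fun S hS => disjoint_left.2 fun i hi hiS =>
        hcon i hi (mem_biUnion.2 ⟨S, hS, hiS⟩)
      have hmem : insert D P ∈ F := by
        refine mem_filter.2 ⟨mem_univ _, ?_, ?_⟩
        · simpa using ⟨hD, hmin⟩
        · rw [coe_insert]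
          exact hd.insert fun S hS _ => hdis S hS
      have hDP : D ∈ P := hP.2 hmem (subset_insert D P) (mem_insert_self D P)
      have := hdis D hDP
      rw [disjoint_self_iff_empty] at this
      exact hD.prop.nonempty.ne_empty this
    exact ⟨i, hDB hi, hiU⟩
  refine (localMeasure_le (witness_subset_fracWitness f x) hw).trans ?_
  rw [sum_boole, filter_mem_eq_inter, univ_inter]
  calc ((P.biUnion id).card : ℝ) ≤ ∑ B ∈ P, (B.card : ℝ) := by
        exact_mod_cast card_biUnion_le
    _ ≤ ∑ B ∈ P, fracCertC I f := sum_le_sum fun B hB => card_le_fracCertC_of_minimal (hmin B hB)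
    _ = P.card * fracCertC I f := by simp
    _ ≤ fracCertC I f * fracCertC I f := mul_le_mul_of_nonneg_right
        (card_le_fracCertC_of_disjoint_blocks (fun B hB => (hmin B hB).prop) hd)
        (fracCertC_nonneg f)
    _ = fracCertC I f ^ 2 := (sq _).symm

theorem boundedByPower_two : BoundedByPower certC fracCertC 2 := by
  refine ⟨1, 0, fun I _ f => ?_⟩
  simpa using certC_le_fracCertC_sq f

end PolynomialBound

/-! ### Spectral radius of 2×2 matrices -/

section Eigenvalue

theorem maxEigenvalue_nonneg (M : Matrix Bool Bool ℝ) : 0 ≤ maxEigenvalue M := by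
  refine Real.sSup_nonneg ?_
  rintro _ ⟨μ, -, rfl⟩
  exact norm_nonneg _

/-- Collatz-Wielandt bound: a nonnegative matrix with `M u ≤ c u` for a positive vector `u` has
spectral radius at most `c`. -/
theorem maxEigenvalue_le {M : Matrix Bool Bool ℝ} (hM : ∀ s t, 0 ≤ M s t) {u : Bool → ℝ}
    (hu : ∀ t, 0 < u t) {c : ℝ} (hc : 0 ≤ c) (h : ∀ s, ∑ t, M s t * u t ≤ c * u s) :
    maxEigenvalue M ≤ c := by
  refine Real.sSup_le ?_ hc
  rintro _ ⟨μ, hμ, rfl⟩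
  obtain ⟨v, hv⟩ := hμ.exists_hasEigenvector
  -- Row `s` of the eigenvector equation is the one to read: there `v` is largest relative to `u`.
  obtain ⟨s, hs⟩ := Finite.exists_max fun t => ‖v t‖ / u t
  set b := ‖v s‖ / u s with hb
  have hle : ∀ t, ‖v t‖ ≤ b * u t := fun t => (div_le_iff₀ (hu t)).1 (hs t)
  have hvs : ‖v s‖ = b * u s := by rw [hb, div_mul_cancel₀ _ (hu s).ne']
  have hbpos : 0 < b := by
    obtain ⟨t, ht⟩ := Function.ne_iff.1 hv.2
    exact (div_pos (norm_pos_iff.2 ht) (hu t)).trans_le (hs t)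
  have heq : ∑ t, (M s t : ℂ) * v t = μ * v s := by
    have := congrFun hv.apply_eq_smul s
    simpa [Matrix.toLin'_apply, Matrix.mulVec, dotProduct] using this
  have h1 : ‖μ‖ * (b * u s) ≤ c * (b * u s) := by
    calc ‖μ‖ * (b * u s) = ‖∑ t, (M s t : ℂ) * v t‖ := by rw [heq, norm_mul, hvs]
      _ ≤ ∑ t, ‖(M s t : ℂ) * v t‖ := norm_sum_le _ _
      _ ≤ ∑ t, b * (M s t * u t) := by
        refine sum_le_sum fun t _ => ?_
        rw [norm_mul, Complex.norm_real, Real.norm_of_nonneg (hM s t)]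
        nlinarith [mul_le_mul_of_nonneg_left (hle t) (hM s t)]
      _ = b * ∑ t, M s t * u t := (mul_sum _ _ _).symm
      _ ≤ b * (c * u s) := mul_le_mul_of_nonneg_left (h s) hbpos.le
      _ = c * (b * u s) := by ring
  exact le_of_mul_le_mul_right h1 (mul_pos hbpos (hu s))

theorem le_maxEigenvalue_of_triangular {M : Matrix Bool Bool ℝ} (h : M false true = 0) :
    M false false ≤ maxEigenvalue M := by
  set N : Matrix Bool Bool ℂ := M.map fun a : ℝ => (a : ℂ) with hN
  -- Finiteness makes the set bounded, so that its `sSup` is a genuine upper bound.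
  have hfin : {r : ℝ | ∃ μ : ℂ, Module.End.HasEigenvalue (Matrix.toLin' N) μ ∧ r = ‖μ‖}.Finite := by
    refine ((Module.End.finite_hasEigenvalue (Matrix.toLin' N)).image fun μ => ‖μ‖).subset ?_
    rintro _ ⟨μ, hμ, rfl⟩
    exact ⟨μ, hμ, rfl⟩
  have hdet : (((M false false : ℂ) • (1 : Matrix Bool Bool ℂ)) - N).det = 0 := by
    refine Matrix.det_eq_zero_of_row_eq_zero false fun t => ?_
    cases t <;> simp [hN, h]
  obtain ⟨v, hv0, hv⟩ := Matrix.exists_mulVec_eq_zero_iff.2 hdet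
  have hev : Module.End.HasEigenvalue (Matrix.toLin' N) (M false false : ℂ) := by
    refine Module.End.hasEigenvalue_of_hasEigenvector (x := v)
      (Module.End.hasEigenvector_iff.2 ⟨Module.End.mem_eigenspace_iff.2 ?_, hv0⟩)
    rw [Matrix.sub_mulVec, Matrix.smul_mulVec, Matrix.one_mulVec, sub_eq_zero] at hv
    rw [Matrix.toLin'_apply, hv]
  refine (le_abs_self _).trans ?_
  rw [← Real.norm_eq_abs, ← Complex.norm_real]
  exact le_csSup hfin.bddAbove ⟨_, hev, rfl⟩

end Eigenvalue

/-! ### Upper bounds from priced fractional witnesses -/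

section UpperBound

variable {I J : Type} [Fintype I] [Fintype J]

/-- `f` has at every assignment `x` a fractional witness whose profile maps the vector `u` below
`c` times the entry of `u` at `f x`. -/
def HasFracProfileBound (f : BoolFun I) (u : Bool → ℝ) (c : ℝ) : Prop :=
  ∀ x, ∃ w ∈ fracWitness I f x, ∑ i, w i * u (x i) ≤ c * u (f x)

theorem HasFracProfileBound.charValue_le {f : BoolFun I} {u : Bool → ℝ} {c : ℝ}
    (h : HasFracProfileBound f u c) (hu : ∀ t, 0 < u t) (hc : 0 ≤ c) :
    charValue fracWitness f ≤ c := by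
  refine Real.sSup_le ?_ hc
  rintro _ ⟨α, hα, rfl⟩
  choose w hw hwc using fun s => h (α s)
  have hbdd : BddBelow (maxEigenvalue '' profileFamily fracWitness f α) := by
    refine ⟨0, ?_⟩
    rintro _ ⟨M, -, rfl⟩
    exact maxEigenvalue_nonneg M
  have hmem : profileMatrix α w ∈ profileFamily fracWitness f α := ⟨w, hw, rfl⟩
  refine (csInf_le hbdd (Set.mem_image_of_mem _ hmem)).trans (maxEigenvalue_le ?_ hu hc ?_)
  · exact fun s t => sum_nonneg fun i _ => ((hw s).1 i).1
  · intro s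
    have h1 : ∑ t, profileMatrix α w s t * u t = ∑ i, w s i * u (α s i) := by
      rw [← sum_fiberwise univ (α s) fun i => w s i * u (α s i)]
      refine sum_congr rfl fun t _ => ?_
      rw [profileMatrix, Matrix.of_apply, sum_mul]
      refine sum_congr rfl fun i hi => ?_
      rw [(mem_filter.1 hi).2]
    rw [h1]
    simpa [hα s] using hwc s

theorem mul_mem_fracWitness_comp {f : BoolFun I} {g : BoolFun J} {x : I × J → Bool} {w : I → ℝ}
    {v : I → J → ℝ} (hw : w ∈ fracWitness I f fun i => g fun j => x (i, j))
    (hv : ∀ i, v i ∈ fracWitness J g fun j => x (i, j)) :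
    (fun p : I × J => w p.1 * v p.1 p.2) ∈ fracWitness (I × J) (comp f g) x := by
  classical
  refine ⟨fun p => ⟨mul_nonneg (hw.1 _).1 ((hv _).1 _).1,
    mul_le_one₀ (hw.1 _).2 ((hv _).1 _).1 ((hv _).1 _).2⟩, fun B hB => ?_⟩
  rw [sum_eq_sum_slice]
  refine (hw.2 _ ((isBlock_comp_iff f g x B).1 hB)).trans ?_
  rw [sum_filter]
  refine sum_le_sum fun i _ => ?_
  dsimp only
  rw [← mul_sum]
  split_ifs with hi
  · exact le_mul_of_one_le_right (hw.1 i).1 ((hv i).2 _ hi)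
  · exact mul_nonneg (hw.1 i).1 (sum_nonneg fun j _ => ((hv i).1 j).1)

/-- The inner witness in copy `i` costs at most `c ^ (k + 1)` times the price of that copy's output,
so the outer inequality contributes one more factor `c`. -/
theorem HasFracProfileBound.exists_iterComp {f : BoolFun I} {u : Bool → ℝ} {c : ℝ}
    (h : HasFracProfileBound f u c) (hu : ∀ t, 1 ≤ u t) (hc : 0 ≤ c) (k : ℕ) :
    ∀ x, ∃ w ∈ fracWitness (IterIndex I k) (iterComp f k) x,
      ∑ i, w i ≤ c ^ (k + 1) * u (iterComp f k x) := by
  induction k with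
  | zero =>
    intro x
    obtain ⟨w, hw, hle⟩ := h x
    refine ⟨w, hw, ?_⟩
    rw [zero_add, pow_one]
    exact (sum_le_sum fun i _ => le_mul_of_one_le_right (hw.1 i).1 (hu (x i))).trans hle
  | succ k ih =>
    intro (x : I × IterIndex I k → Bool)
    choose v hv hvc using fun i => ih fun j => x (i, j)
    obtain ⟨w, hw, hle⟩ := h fun i => iterComp f k fun j => x (i, j)
    refine ⟨_, mul_mem_fracWitness_comp hw hv, ?_⟩
    have h1 : ∑ p : I × IterIndex I k, w p.1 * v p.1 p.2 = ∑ i, w i * ∑ j, v i j := by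
      rw [Fintype.sum_prod_type]
      simp only [mul_sum]
    refine h1.trans_le ?_
    calc ∑ i, w i * ∑ j, v i j
        ≤ ∑ i, c ^ (k + 1) * (w i * u (iterComp f k fun j => x (i, j))) := by
          refine sum_le_sum fun i _ => ?_
          rw [mul_left_comm]
          exact mul_le_mul_of_nonneg_left (hvc i) (hw.1 i).1
      _ = c ^ (k + 1) * ∑ i, w i * u (iterComp f k fun j => x (i, j)) := (mul_sum _ _ _).symm
      _ ≤ c ^ (k + 1) * (c * u (f fun i => iterComp f k fun j => x (i, j))) :=
          mul_le_mul_of_nonneg_left hle (pow_nonneg hc _)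
      _ = c ^ (k + 1 + 1) * u (f fun i => iterComp f k fun j => x (i, j)) := by ring

theorem HasFracProfileBound.fracCertC_iterComp_le {f : BoolFun I} {u : Bool → ℝ} {c K : ℝ}
    (h : HasFracProfileBound f u c) (hu : ∀ t, 1 ≤ u t) (huK : ∀ t, u t ≤ K) (hc : 0 ≤ c)
    (k : ℕ) : fracCertC (IterIndex I k) (iterComp f k) ≤ c ^ (k + 1) * K := by
  have hK : 0 ≤ K := zero_le_one.trans ((hu true).trans (huK true))
  refine measure_le (by positivity) fun x => ?_
  obtain ⟨w, hw, hle⟩ := h.exists_iterComp hu hc k x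
  exact ((localMeasure_le subset_rfl hw).trans hle).trans
    (mul_le_mul_of_nonneg_left (huK _) (pow_nonneg hc _))

theorem pow_succ_rpow_one_div {c : ℝ} (hc : 0 ≤ c) (k : ℕ) :
    (c ^ (k + 1)) ^ (1 / ((k : ℝ) + 1)) = c := by
  have := Real.pow_rpow_inv_natCast hc (Nat.succ_ne_zero k)
  simpa using this

/-- The constant `K` disappears in the limit, as its (k+1)-st root tends to 1. -/
theorem compLimit_fracCertC_le {f : BoolFun I} {c K : ℝ} (hc : 0 ≤ c) (hK : 0 < K)
    (h : ∀ k, fracCertC (IterIndex I k) (iterComp f k) ≤ c ^ (k + 1) * K) :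
    compLimit fracCertC f ≤ c := by
  have hlim : Tendsto (fun k : ℕ => c * K ^ (1 / ((k : ℝ) + 1))) atTop (𝓝 c) := by
    have := ((Real.continuous_const_rpow hK.ne').tendsto 0).comp
      (tendsto_one_div_add_atTop_nhds_zero_nat (𝕜 := ℝ))
    simpa [Function.comp_def] using this.const_mul c
  rw [← hlim.liminf_eq]
  refine liminf_le_liminf (Eventually.of_forall fun k => ?_) ?_
    hlim.isBoundedUnder_le.isCoboundedUnder_ge
  · calc _ ≤ (c ^ (k + 1) * K) ^ (1 / ((k : ℝ) + 1)) :=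
          Real.rpow_le_rpow (fracCertC_nonneg _) (h k) (by positivity)
      _ = c * K ^ (1 / ((k : ℝ) + 1)) := by
          rw [Real.mul_rpow (by positivity) hK.le, pow_succ_rpow_one_div hc]
  · exact ⟨0, eventually_map.2 (Eventually.of_forall fun k =>
      Real.rpow_nonneg (fracCertC_nonneg _) _)⟩

end UpperBound

/-! ### Lower bounds from 0/1 witnesses at zero -/

section LowerBound

variable {I J : Type} [Fintype I] [Fintype J]

/-- The copies on which `w` restricts to a witness of `g` must form a witness of `f`. Otherwise
blocks of `g` missed by `w` assemble into a block of `f ∘ g` missed by `w`. -/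
theorem mul_le_sum_witness_comp {f : BoolFun I} {g : BoolFun J} {x : I × J → Bool} {a b : ℝ}
    (hb : 0 ≤ b) (hf : ∀ w ∈ witness I f fun i => g fun j => x (i, j), a ≤ ∑ i, w i)
    (hg : ∀ i, ∀ w ∈ witness J g fun j => x (i, j), b ≤ ∑ j, w j) :
    ∀ w ∈ witness (I × J) (comp f g) x, a * b ≤ ∑ p, w p := by
  classical
  intro w hw
  have hnn : ∀ p, 0 ≤ w p := fun p => by rcases hw.1 p with h | h <;> simp [h]
  let P : Finset I := univ.filter fun i => (fun j => w (i, j)) ∈ witness J g fun j => x (i, j)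
  have hP : ∀ i, i ∈ P ↔ (fun j => w (i, j)) ∈ witness J g fun j => x (i, j) := by simp [P]
  have hv : (fun i => if i ∈ P then (1 : ℝ) else 0) ∈ witness I f fun i => g fun j => x (i, j) := by
    refine indicator_mem_witness fun S hS => ?_
    by_contra! hcon
    have hex : ∀ i, ∃ B : Finset J, (i ∈ S → IsBlock g (fun j => x (i, j)) B ∧
        ∑ j ∈ B, w (i, j) < 1) ∧ (i ∉ S → B = ∅) := by
      intro i
      by_cases hi : i ∈ S
      · have h1 := (hP i).not.1 (hcon i hi)
        have h2 : ¬ ∀ B : Finset J, IsBlock g (fun j => x (i, j)) B → 1 ≤ ∑ j ∈ B, w (i, j) :=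
          fun h => h1 ⟨fun j => hw.1 (i, j), h⟩
        push Not at h2
        obtain ⟨B, hB⟩ := h2
        exact ⟨B, fun _ => hB, fun h => absurd hi h⟩
      · exact ⟨∅, fun h => absurd h hi, fun _ => rfl⟩
    choose B hB hB0 using hex
    let U : Finset (I × J) := univ.filter fun p => p.2 ∈ B p.1
    have hsl : ∀ i, slice U i = B i := fun i => by ext j; simp [slice, U]
    have hU : IsBlock (comp f g) x U := by
      rw [isBlock_comp_iff]
      convert hS using 1
      ext i
      simp only [mem_filter, mem_univ, true_and, hsl]
      refine ⟨fun h => ?_, fun h => (hB i h).1⟩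
      by_contra hi
      rw [hB0 i hi] at h
      simpa using h.nonempty
    have hsum := hw.2 U hU
    rw [sum_eq_sum_slice] at hsum
    -- Integrality enters here: a 0/1 weight below 1 on a block is 0, so the total over all copies
    -- is 0 as well.
    refine absurd hsum (not_le.2 (lt_of_le_of_lt (le_of_eq ?_) zero_lt_one))
    refine sum_eq_zero fun i _ => ?_
    rw [hsl]
    by_cases hi : i ∈ S
    · refine sum_eq_zero fun j hj => ?_
      rcases hw.1 (i, j) with h | h
      · exact h
      · have h1 := (hB i hi).2
        have h2 := single_le_sum (f := fun j => w (i, j)) (fun j _ => hnn (i, j)) hj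
        rw [h] at h2
        exact absurd h1 (not_lt.2 h2)
    · rw [hB0 i hi, sum_empty]
  calc a * b ≤ (∑ i, if i ∈ P then (1 : ℝ) else 0) * b := mul_le_mul_of_nonneg_right (hf _ hv) hb
    _ = ∑ i, if i ∈ P then b else 0 := by rw [sum_mul]; simp only [ite_mul, one_mul, zero_mul]
    _ ≤ ∑ i, ∑ j, w (i, j) := by
        refine sum_le_sum fun i _ => ?_
        split_ifs with hi
        · exact hg i _ ((hP i).1 hi)
        · exact sum_nonneg fun j _ => hnn (i, j)
    _ = ∑ p, w p := (Fintype.sum_prod_type w).symm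

/-- Composition powers of a function that vanishes at the zero assignment vanish there. -/
theorem iterComp_zero {I : Type} {f : BoolFun I} (h0 : f (fun _ => false) = false) (k : ℕ) :
    iterComp f k (fun _ => false) = false := by
  induction k with
  | zero => exact h0
  | succ k ih =>
    change f (fun _ => iterComp f k fun _ => false) = false
    rw [ih, h0]

theorem pow_le_sum_witness_iterComp {f : BoolFun I} (h0 : f (fun _ => false) = false) {a : ℝ}
    (ha : 0 ≤ a) (hf : ∀ w ∈ witness I f fun _ => false, a ≤ ∑ i, w i) (k : ℕ) :
    ∀ w ∈ witness (IterIndex I k) (iterComp f k) fun _ => false, a ^ (k + 1) ≤ ∑ i, w i := by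
  induction k with
  | zero =>
    intro w hw
    rw [zero_add, pow_one]
    exact hf w hw
  | succ k ih =>
    rw [pow_succ']
    refine mul_le_sum_witness_comp (f := f) (g := iterComp f k) (x := fun _ => false)
      (pow_nonneg ha _) ?_ fun _ => ih
    rw [iterComp_zero h0]
    exact hf

theorem pow_le_certC_iterComp {f : BoolFun I} (h0 : f (fun _ => false) = false) {a : ℝ}
    (ha : 0 ≤ a) (hf : ∀ w ∈ witness I f fun _ => false, a ≤ ∑ i, w i) (k : ℕ) :
    a ^ (k + 1) ≤ certC (IterIndex I k) (iterComp f k) :=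
  (le_localMeasure subset_rfl (pow_le_sum_witness_iterComp h0 ha hf k)).trans
    (localMeasure_le_measure _ _ _)

theorem card_iterIndex (I : Type) [Fintype I] (k : ℕ) :
    Fintype.card (IterIndex I k) = Fintype.card I ^ (k + 1) := by
  induction k with
  | zero => rw [zero_add, pow_one]; rfl
  | succ k ih =>
    rw [pow_succ', ← ih]
    exact Fintype.card_prod I (IterIndex I k)

theorem le_compLimit_certC {f : BoolFun I} {a : ℝ} (ha : 0 ≤ a)
    (h : ∀ k, a ^ (k + 1) ≤ certC (IterIndex I k) (iterComp f k)) :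
    a ≤ compLimit certC f := by
  refine le_liminf_of_le ?_ (Eventually.of_forall fun k => ?_)
  -- A real `liminf` is meaningful only with an upper bound; the trivial bound on C by the number of
  -- variables supplies one.
  · refine IsBoundedUnder.isCoboundedUnder_ge
      ⟨(Fintype.card I : ℝ), eventually_map.2 (Eventually.of_forall fun k => ?_)⟩
    calc _ ≤ ((Fintype.card I : ℝ) ^ (k + 1)) ^ (1 / ((k : ℝ) + 1)) := by
          refine Real.rpow_le_rpow ((pow_nonneg ha _).trans (h k)) ?_ (by positivity)
          have := certC_le_card (iterComp f k)
          rwa [card_iterIndex, Nat.cast_pow] at this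
      _ = Fintype.card I := pow_succ_rpow_one_div (Nat.cast_nonneg _) k
  · calc a = (a ^ (k + 1)) ^ (1 / ((k : ℝ) + 1)) := (pow_succ_rpow_one_div ha k).symm
      _ ≤ _ := Real.rpow_le_rpow (pow_nonneg ha _) (h k) (by positivity)

theorem le_charValue_witness {f : BoolFun I} (h0 : f (fun _ => false) = false) {y : I → Bool}
    (hy : f y = true) {a : ℝ} (hf : ∀ w ∈ witness I f fun _ => false, a ≤ ∑ i, w i) :
    a ≤ charValue witness f := by
  let α : Bool → I → Bool := fun b => bif b then y else fun _ => false
  have hα : IsCompatible f α := fun b => by cases b <;> simp [α, h0, hy]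
  have h1 : a ≤ charValueAt witness f α := by
    refine le_csInf ⟨_, _, ⟨fun _ _ => 1, fun b => one_mem_witness f _, rfl⟩, rfl⟩ ?_
    rintro _ ⟨_, ⟨w, hw, rfl⟩, rfl⟩
    refine le_trans ?_ (le_maxEigenvalue_of_triangular ?_)
    · simpa [profileMatrix, α] using hf _ (hw false)
    · simp [profileMatrix, α]
  exact h1.trans (le_csSup ((Set.toFinite _).image _).bddAbove ⟨α, hα, rfl⟩)

end LowerBound

/-! ### The single group function -/

section SingleGroup

/-- `f` accepts the assignments with at least `m` ones, all of them in one fibre of `γ`. -/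
def IsSingleGroup {I G : Type} [Fintype I] (f : BoolFun I) (γ : I → G) (m : ℕ) : Prop :=
  ∀ x, f x = true ↔ m ≤ (univ.filter fun i => x i = true).card ∧
    ∀ i j, x i = true → x j = true → γ i = γ j

variable {I G : Type} [Fintype I] {f : BoolFun I} {γ : I → G} {m : ℕ}

theorem IsSingleGroup.apply_zero (hf : IsSingleGroup f γ m) (hm : 0 < m) :
    f (fun _ => false) = false := by
  rw [← Bool.not_eq_true, hf]
  simpa using fun h => absurd h hm.ne'

/-- If `m` variables of one group had weight 0, they would form a block of weight 0. So at least
half of each group has weight 1. -/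
theorem IsSingleGroup.half_le_sum_witness [Fintype G] [DecidableEq G] (hf : IsSingleGroup f γ m) (hm : 0 < m)
    (hγ : ∀ g, (univ.filter fun i => γ i = g).card = 2 * m) :
    ∀ w ∈ witness I f fun _ => false, (Fintype.card I : ℝ) / 2 ≤ ∑ i, w i := by
  classical
  intro w hw
  have hnn : ∀ p, 0 ≤ w p := fun p => by rcases hw.1 p with h | h <;> simp [h]
  have hgroup : ∀ g, (m : ℝ) ≤ ∑ i with γ i = g, w i := by
    intro g
    let Z : Finset I := univ.filter fun i => γ i = g ∧ w i = 0
    have hones : ∀ i, flipBits (fun _ => false) Z i = true ↔ i ∈ Z := fun i => by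
      by_cases h : i ∈ Z
      · simp [flipBits_of_mem h, h]
      · simp [flipBits_of_notMem h, h]
    have hZ : Z.card < m := by
      by_contra! hcon
      have hb : IsBlock f (fun _ => false) Z := by
        rw [IsBlock, hf.apply_zero hm]
        have : f (flipBits (fun _ => false) Z) = true := by
          rw [hf]
          simp only [hones]
          refine ⟨by simpa using hcon, fun i j hi hj => ?_⟩
          rw [(mem_filter.1 hi).2.1, (mem_filter.1 hj).2.1]
        simp [this]
      have := hw.2 Z hb
      rw [sum_eq_zero fun i hi => (mem_filter.1 hi).2.2] at this
      linarith
    have hsplit : ∑ i with γ i = g, w i = ((univ.filter fun i => γ i = g ∧ w i ≠ 0).card : ℝ) := by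
      rw [← filter_filter, card_filter, Nat.cast_sum]
      refine sum_congr rfl fun i _ => ?_
      rcases hw.1 i with h | h <;> simp [h]
    rw [hsplit]
    have h1 := card_filter_add_card_filter_not (s := univ.filter fun i => γ i = g) fun i => w i = 0
    rw [filter_filter, filter_filter, hγ g] at h1
    have h2 : m ≤ (univ.filter fun i => γ i = g ∧ w i ≠ 0).card := by
      change Z.card + _ = _ at h1
      simp only [ne_eq]
      omega
    exact_mod_cast h2
  have hcard : Fintype.card I = Fintype.card G * (2 * m) := by
    rw [← card_univ, card_eq_sum_card_fiberwise (t := univ) (fun i _ => mem_univ (γ i))]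
    simp [hγ]
  calc (Fintype.card I : ℝ) / 2 = ∑ _g : G, (m : ℝ) := by
        rw [hcard]; push_cast; simp; ring
    _ ≤ ∑ g, ∑ i with γ i = g, w i := sum_le_sum fun g _ => hgroup g
    _ = ∑ i, w i := sum_fiberwise univ γ w

theorem IsSingleGroup.exists_apply_true [Nonempty G] [DecidableEq G] (hf : IsSingleGroup f γ m)
    (hγ : ∀ g, (univ.filter fun i => γ i = g).card = 2 * m) : ∃ y, f y = true := by
  let g := Classical.arbitrary G
  refine ⟨fun i => decide (γ i = g), (hf _).2 ?_⟩
  simp only [decide_eq_true_eq, hγ]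
  exact ⟨by omega, fun i j hi hj => hi.trans hj.symm⟩

theorem IsSingleGroup.hasFracProfileBound [DecidableEq G] (hf : IsSingleGroup f γ m) (hm : 0 < m)
    (hγ : ∀ g, (univ.filter fun i => γ i = g).card ≤ 2 * m) (hI : Fintype.card I ≤ m ^ 2) :
    HasFracProfileBound f (fun b => if b = true then (m : ℝ) else 1) (4 * m) := by
  classical
  intro x
  have hm' : (1 : ℝ) ≤ m := by exact_mod_cast hm
  cases hfx : f x
  · have hblock : ∀ B, IsBlock f x B → f (flipBits x B) = true := fun B hB => by
      rw [IsBlock, hfx] at hB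
      simpa using hB
    by_cases hone : ∃ i, x i = true
    · by_cases htwo : ∃ i j, x i = true ∧ x j = true ∧ γ i ≠ γ j
      · obtain ⟨i, j, hi, hj, hij⟩ := htwo
        -- Two ones in different groups certify rejection, at price 2m.
        refine ⟨_, witness_subset_fracWitness f x (indicator_mem_witness (S := {i, j})
          fun B hB => ?_), ?_⟩
        · by_contra! hcon
          have hiB : i ∉ B := fun h => hcon i h (by simp)
          have hjB : j ∉ B := fun h => hcon j h (by simp)
          refine hij (((hf _).1 (hblock B hB)).2 i j ?_ ?_)
          · rwa [flipBits_of_notMem hiB]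
          · rwa [flipBits_of_notMem hjB]
        · have hne : i ≠ j := fun h => hij (by rw [h])
          simp only [ite_mul, one_mul, zero_mul, ← sum_filter, filter_mem_eq_inter, univ_inter]
          rw [sum_pair hne]
          simp only [hi, hj, if_true, Bool.false_eq_true, if_false]
          linarith
      · obtain ⟨i, hi⟩ := hone
        push Not at htwo
        have hcard : (univ.filter fun i => x i = true).card < m := by
          by_contra! hcon
          have := (hf x).2 ⟨hcon, fun i j hi hj => htwo i j hi hj⟩
          simp [hfx] at this
        -- With the one at `i` kept, acceptance confines all ones to its group, and fewer than `m`
        -- are there already. Fixing `i` and the zeros of its group costs at most m + 2m.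
        let Z : Finset I := univ.filter fun j => γ j = γ i ∧ x j = false
        refine ⟨_, witness_subset_fracWitness f x (indicator_mem_witness (S := insert i Z)
          fun B hB => ?_), ?_⟩
        · by_contra! hcon
          obtain ⟨h1, h2⟩ := (hf _).1 (hblock B hB)
          have hiB : i ∉ B := fun h => hcon i h (by simp)
          refine absurd (h1.trans (card_le_card fun j hj => ?_)) (not_le.2 hcard)
          replace hj := (mem_filter.1 hj).2
          refine mem_filter.2 ⟨mem_univ _, ?_⟩
          by_cases hjB : j ∈ B
          · have hxj : x j = false := by
              rw [flipBits_of_mem hjB] at hj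
              simpa using hj
            refine absurd ?_ (hcon j hjB)
            refine mem_insert_of_mem (mem_filter.2 ⟨mem_univ _, ?_, hxj⟩)
            exact h2 j i hj (by rwa [flipBits_of_notMem hiB])
          · rwa [flipBits_of_notMem hjB] at hj
        · have hiZ : i ∉ Z := by simp [Z, hi]
          have hZ : (Z.card : ℝ) ≤ 2 * m := by
            exact_mod_cast (card_le_card fun j hj => by
              simpa using (mem_filter.1 hj).2.1).trans (hγ (γ i))
          have hsum : ∑ j ∈ Z, (if x j = true then (m : ℝ) else 1) = Z.card := by
            rw [card_eq_sum_ones, Nat.cast_sum]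
            refine sum_congr rfl fun j hj => ?_
            simp [(mem_filter.1 hj).2.2]
          simp only [ite_mul, one_mul, zero_mul, ← sum_filter, filter_mem_eq_inter, univ_inter]
          rw [sum_insert hiZ, hsum]
          simp only [hi, if_true, Bool.false_eq_true, if_false]
          linarith
    · push Not at hone
      have hx : ∀ i, x i = false := fun i => by simpa using hone i
      -- Every block at zero has at least `m` elements, so uniform weight 1/m suffices, at price at
      -- most m²/m = m.
      refine ⟨fun _ => 1 / m, ⟨fun i => ⟨by positivity, ?_⟩, fun B hB => ?_⟩, ?_⟩
      · rw [div_le_one (by positivity)]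
        exact hm'
      · have h1 : m ≤ B.card := by
          refine ((hf _).1 (hblock B hB)).1.trans (card_le_card fun j hj => ?_)
          replace hj := (mem_filter.1 hj).2
          by_contra hjB
          rw [flipBits_of_notMem hjB, hx] at hj
          simp at hj
        rw [sum_const, nsmul_eq_mul, mul_one_div, le_div_iff₀ (by positivity), one_mul]
        exact_mod_cast h1
      · simp only [hx, Bool.false_eq_true, if_false, mul_one, sum_const, card_univ, nsmul_eq_mul]
        rw [mul_one_div, div_le_iff₀ (by positivity)]
        have : (Fintype.card I : ℝ) ≤ m ^ 2 := by exact_mod_cast hI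
        nlinarith
  -- At an accepting assignment the full weight is affordable: at most 2m ones priced m and m² zeros
  -- priced 1 give 3m², against the allowance 4m · m.
  · refine ⟨fun _ => 1, witness_subset_fracWitness f x (one_mem_witness f x), ?_⟩
    obtain ⟨h1, h2⟩ := (hf x).1 hfx
    obtain ⟨i, hi⟩ := card_pos.1 (hm.trans_le h1)
    have hones : ((univ.filter fun i => x i = true).card : ℝ) ≤ 2 * m := by
      exact_mod_cast (card_le_card fun j hj => by
        simpa using h2 j i (mem_filter.1 hj).2 (mem_filter.1 hi).2).trans (hγ (γ i))
    have hI' : (Fintype.card I : ℝ) ≤ m ^ 2 := by exact_mod_cast hI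
    calc ∑ i, 1 * (if x i = true then (m : ℝ) else 1)
        ≤ ∑ i, ((if x i = true then (m : ℝ) else 0) + 1) := by
          refine sum_le_sum fun i _ => ?_
          split_ifs <;> linarith
      _ = (univ.filter fun i => x i = true).card * m + Fintype.card I := by
          rw [sum_add_distrib, ← sum_filter]
          simp
      _ ≤ 4 * m * m := by nlinarith
      _ = _ := by simp

/-- The groups of `singleGroup n k d`. -/
def groupOf {n k : ℕ} (h : k ∣ n) (i : Fin n) : Fin (n / k) :=
  ⟨i / k, Nat.div_lt_div_of_lt_of_dvd h i.2⟩

theorem card_groupOf {n k : ℕ} (hk : 0 < k) (h : k ∣ n) (g : Fin (n / k)) :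
    (univ.filter fun i => groupOf h i = g).card = k := by
  have hg : (g + 1) * k ≤ n := (Nat.le_div_iff_mul_le hk).1 g.2
  have : (univ.filter fun i => groupOf h i = g).map Fin.valEmbedding =
      Ico (g * k) ((g + 1) * k) := by
    ext j
    simp only [Finset.mem_map, mem_filter, mem_univ, true_and, Fin.valEmbedding_apply, mem_Ico,
      groupOf, Fin.ext_iff]
    constructor
    · rintro ⟨i, hi, rfl⟩
      rw [← Nat.le_div_iff_mul_le hk, ← Nat.div_lt_iff_lt_mul hk]
      omega
    · rintro ⟨h1, h2⟩
      refine ⟨⟨j, h2.trans_le hg⟩, ?_, rfl⟩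
      rw [← Nat.le_div_iff_mul_le hk] at h1
      rw [← Nat.div_lt_iff_lt_mul hk] at h2
      change j / k = g
      omega
  rw [← card_map Fin.valEmbedding, this, Nat.card_Ico, Nat.succ_mul]
  omega

theorem isSingleGroup_singleGroup {n k d : ℕ} (hd : 0 < d) (h : k ∣ n) :
    IsSingleGroup (singleGroup n k d) (groupOf h) d := by
  intro x
  rw [singleGroup, decide_eq_true_iff]
  refine and_congr_right fun hcard => ⟨?_, fun hx => ?_⟩
  · rintro ⟨g, hg⟩ i j hi hj
    exact Fin.ext ((hg i hi).trans (hg j hj).symm)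
  · obtain ⟨i, hi⟩ := card_pos.1 (hd.trans_le hcard)
    exact ⟨groupOf h i, fun j hj => congrArg Fin.val (hx j i hj (mem_filter.1 hi).2)⟩

theorem two_mul_dvd_sq {m : ℕ} (he : Even m) : 2 * m ∣ m * m :=
  mul_dvd_mul_right he.two_dvd m

theorem hasFracProfileBound_singleGroup {m : ℕ} (hm : 0 < m) (he : Even m) :
    HasFracProfileBound (singleGroup (m * m) (2 * m) m)
      (fun b => if b = true then (m : ℝ) else 1) (4 * m) :=
  (isSingleGroup_singleGroup hm (two_mul_dvd_sq he)).hasFracProfileBound hm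
    (fun g => (card_groupOf (by omega) (two_mul_dvd_sq he) g).le) (by simp [sq])

theorem fracCertC_iterComp_singleGroup_le {m : ℕ} (hm : 0 < m) (he : Even m) (k : ℕ) :
    fracCertC _ (iterComp (singleGroup (m * m) (2 * m) m) k) ≤ (4 * m : ℝ) ^ (k + 1) * m := by
  have hm' : (1 : ℝ) ≤ m := by exact_mod_cast hm
  refine (hasFracProfileBound_singleGroup hm he).fracCertC_iterComp_le (fun t => ?_) (fun t => ?_)
    (by positivity) k
  · cases t
    · simp
    · simpa using hm'
  · cases t
    · simpa using hm'
    · simp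

theorem half_le_sum_witness_singleGroup {m : ℕ} (hm : 0 < m) (he : Even m) :
    ∀ w ∈ witness _ (singleGroup (m * m) (2 * m) m) fun _ => false,
      ((m * m : ℕ) : ℝ) / 2 ≤ ∑ i, w i := by
  have := (isSingleGroup_singleGroup hm (two_mul_dvd_sq he)).half_le_sum_witness hm
    (card_groupOf (by omega) (two_mul_dvd_sq he))
  rwa [Fintype.card_fin] at this

theorem pow_le_certC_iterComp_singleGroup {m : ℕ} (hm : 0 < m) (he : Even m) (k : ℕ) :
    (((m * m : ℕ) : ℝ) / 2) ^ (k + 1) ≤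
      certC _ (iterComp (singleGroup (m * m) (2 * m) m) k) :=
  pow_le_certC_iterComp ((isSingleGroup_singleGroup hm (two_mul_dvd_sq he)).apply_zero hm)
    (by positivity) (half_le_sum_witness_singleGroup hm he) k

theorem half_le_charValue_singleGroup {m : ℕ} (hm : 0 < m) (he : Even m) :
    ((m * m : ℕ) : ℝ) / 2 ≤ charValue witness (singleGroup (m * m) (2 * m) m) := by
  have hf := isSingleGroup_singleGroup hm (two_mul_dvd_sq he)
  have : Nonempty (Fin (m * m / (2 * m))) :=
    ⟨⟨0, Nat.div_pos (Nat.le_of_dvd (by positivity) (two_mul_dvd_sq he)) (by omega)⟩⟩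
  obtain ⟨y, hy⟩ := hf.exists_apply_true (card_groupOf (by omega) (two_mul_dvd_sq he))
  exact le_charValue_witness (hf.apply_zero hm) hy (half_le_sum_witness_singleGroup hm he)

end SingleGroup

/-! ### The critical exponent -/

section CriticalExponent

theorem exists_even_four_mul_rpow_lt {r : ℝ} (hr : r < 2) :
    ∃ m : ℕ, 0 < m ∧ Even m ∧ (4 * m : ℝ) ^ r < ((m * m : ℕ) : ℝ) / 2 := by
  have hlim : Tendsto (fun a : ℕ => ((2 * a : ℕ) : ℝ) ^ (2 - r)) atTop atTop :=
    (tendsto_rpow_atTop (by linarith)).comp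
      (tendsto_natCast_atTop_atTop.comp (tendsto_id.const_mul_atTop' two_pos))
  obtain ⟨a, ha, ha0⟩ :=
    ((hlim.eventually_gt_atTop (2 * (4 : ℝ) ^ r)).and (eventually_gt_atTop 0)).exists
  refine ⟨2 * a, by omega, even_two_mul a, ?_⟩
  have hm : (0 : ℝ) < (2 * a : ℕ) := by exact_mod_cast (by omega : 0 < 2 * a)
  have hpos : 0 < ((2 * a : ℕ) : ℝ) ^ r := Real.rpow_pos_of_pos hm r
  have hsplit : ((2 * a : ℕ) : ℝ) ^ (2 - r) * ((2 * a : ℕ) : ℝ) ^ r =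
      (2 * a : ℕ) * (2 * a : ℕ) := by
    rw [← Real.rpow_add hm, sub_add_cancel, Real.rpow_two, sq]
  rw [Real.mul_rpow (by norm_num) hm.le, Nat.cast_mul (2 * a), lt_div_iff₀ two_pos, ← hsplit]
  calc (4 : ℝ) ^ r * ((2 * a : ℕ) : ℝ) ^ r * 2 = 2 * (4 : ℝ) ^ r * ((2 * a : ℕ) : ℝ) ^ r := by ring
    _ < _ := mul_lt_mul_of_pos_right ha hpos

theorem two_le_of_boundedByPower {r : ℝ} (hr : 0 < r) (h : BoundedByPower certC fracCertC r) :
    2 ≤ r := by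
  by_contra! hr2
  obtain ⟨c₁, c₂, h⟩ := h
  obtain ⟨m, hm, he, hlt⟩ := exists_even_four_mul_rpow_lt hr2
  have hm' : (1 : ℝ) ≤ m := by exact_mod_cast hm
  set A : ℝ := (4 * m : ℝ) ^ r with hA
  set L : ℝ := ((m * m : ℕ) : ℝ) / 2
  have hA1 : 1 ≤ A := Real.one_le_rpow (by linarith) hr.le
  have hA0 : 0 < A := zero_lt_one.trans_le hA1
  set D : ℝ := |c₁| * (m : ℝ) ^ r + |c₂|
  -- Here `m` is fixed and only the iteration depth grows, so `D` is a constant, while L / A > 1 by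
  -- the choice of `m`.
  have hbound : ∀ k : ℕ, (L / A) ^ (k + 1) ≤ D := by
    intro k
    rw [div_pow, div_le_iff₀ (by positivity)]
    have hpow : 1 ≤ A ^ (k + 1) := one_le_pow₀ hA1
    calc L ^ (k + 1) ≤ certC _ (iterComp (singleGroup (m * m) (2 * m) m) k) :=
          pow_le_certC_iterComp_singleGroup hm he k
      _ ≤ c₁ * fracCertC _ (iterComp (singleGroup (m * m) (2 * m) m) k) ^ r + c₂ := h _ _
      _ ≤ |c₁| * ((4 * m : ℝ) ^ (k + 1) * m) ^ r + |c₂| := by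
          refine add_le_add (mul_le_mul (le_abs_self _) ?_
            (Real.rpow_nonneg (fracCertC_nonneg _) _) (abs_nonneg _)) (le_abs_self _)
          exact Real.rpow_le_rpow (fracCertC_nonneg _)
            (fracCertC_iterComp_singleGroup_le hm he k) hr.le
      _ = |c₁| * (m : ℝ) ^ r * A ^ (k + 1) + |c₂| := by
          rw [Real.mul_rpow (by positivity) (by positivity), ← Real.rpow_pow_comm (by positivity),
            ← hA]
          ring
      _ ≤ D * A ^ (k + 1) := by
          rw [add_mul]
          exact add_le_add_right (le_mul_of_one_le_right (abs_nonneg _) hpow) _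
  have hLA : 1 < L / A := (one_lt_div hA0).2 hlt
  obtain ⟨k, hk⟩ := pow_unbounded_of_one_lt D hLA
  exact absurd (hbound k) (not_le.2 (hk.trans (pow_lt_pow_right₀ hLA k.lt_succ_self)))

end CriticalExponent

end BoolComplexity

theorem mainTheorem4 :
    (∀ n : ℕ, 0 < n → Even n → IsSquare n →
      BoolComplexity.charValue BoolComplexity.fracWitness
          (BoolComplexity.singleGroup n (2 * Nat.sqrt n) (Nat.sqrt n)) ≤ 4 * Real.sqrt (n : ℝ) ∧
      (n : ℝ) / 2 ≤ BoolComplexity.charValue BoolComplexity.witness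
          (BoolComplexity.singleGroup n (2 * Nat.sqrt n) (Nat.sqrt n)) ∧
      BoolComplexity.compLimit BoolComplexity.fracCertC
          (BoolComplexity.singleGroup n (2 * Nat.sqrt n) (Nat.sqrt n)) ≤ 4 * Real.sqrt (n : ℝ) ∧
      (n : ℝ) / 2 ≤ BoolComplexity.compLimit BoolComplexity.certC
          (BoolComplexity.singleGroup n (2 * Nat.sqrt n) (Nat.sqrt n))) ∧
    BoolComplexity.PolynomiallyBounded BoolComplexity.certC BoolComplexity.fracCertC ∧
    2 ≤ BoolComplexity.crit BoolComplexity.certC BoolComplexity.fracCertC := by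
  open BoolComplexity in
  refine ⟨fun n hn he hsq => ?_, ⟨2, two_pos, boundedByPower_two⟩,
    le_csInf ⟨2, two_pos, boundedByPower_two⟩ fun r hr => two_le_of_boundedByPower hr.1 hr.2⟩
  obtain ⟨m, rfl⟩ := hsq
  have hm : 0 < m := Nat.pos_of_mul_pos_left hn
  have he' : Even m := by simpa [Nat.even_mul] using he
  have hm' : (1 : ℝ) ≤ m := by exact_mod_cast hm
  have hsqrt : Real.sqrt ((m * m : ℕ) : ℝ) = m := by
    rw [Nat.cast_mul, Real.sqrt_mul_self (Nat.cast_nonneg m)]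
  rw [Nat.sqrt_eq, hsqrt]
  refine ⟨(hasFracProfileBound_singleGroup hm he').charValue_le (fun t => ?_) (by positivity),
    half_le_charValue_singleGroup hm he',
    compLimit_fracCertC_le (by positivity) (by positivity)
      (fracCertC_iterComp_singleGroup_le hm he'),
    le_compLimit_certC (by positivity) (pow_le_certC_iterComp_singleGroup hm he')⟩
  cases t
  · simp
  · simpa using hm
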